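/- For integers $q\ge 0$, $s_1,\dots,s_q\in\mathbb{Z}$ and complex numbers $w_1,\dots,w_q$, put $$\mathrm{La}_{s_1,\dots,s_q}(w_1,\dots,w_q)=\sum_{k_1\ge\cdots\ge k_q\ge1}\frac{w_1^{k_1}\cdots w_q^{k_q}}{k_1^{s_1}\cdots k_q^{s_q}}$$ whenever this series converges absolutely; for $q=0$ this is the constant $1$. Write $(x)_m=x(x+1)\cdots(x+m-1)$. Theorem. Let $p\ge1$, let $P\in\mathbb{Q}[X_1,\dots,X_p]$, and let $A_j\ge1$ and $n_j\ge0$ $(1\le j\le p)$ be integers. Then there exist finitely many data $(q_t,\underline{s}_t,\underline{S}_t,c_t)$, $t=1,\dots,m$, depending only on $P$ and the $A_j,n_j$ (and not on $z$), where - $q_t$ is an integer with $0\le q_t\le p$; - $\underline{s}_t=(s_{t,1},\dots,s_{t,q_t})$ is a tuple of integers of any sign with $\sum_{i=1}^{q_t}\max(s_{t,i},0)\le\sum_{j=1}^pA_j$; - $\underline{S}_t=(S_{t,1},\dots,S_{t,q_t})$ is a tuple of non-empty subsets of $\{1,\dots,p\}$; - $c_t\in\mathbb{Q}[z_1^{\pm1},\dots,z_p^{\pm1}]$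 is a Laurent polynomial, such that for all $z_1,\dots,z_p\in\mathbb{C}$ with $|z_1|>1$ and $|z_j|\ge1$ for $j=2,\dots,p$ the following holds. Put $\widehat z_{t,i}=\prod_{j\in S_{t,i}}z_j$. Then the series defining $\mathrm{La}_{\underline{s}_t}(1/\widehat z_{t,1},\dots,1/\widehat z_{t,q_t})$ converges absolutely for every $t$, and $$\sum_{k_1\ge\cdots\ge k_p\ge1}\frac{P(k_1,\dots,k_p)}{(k_1)_{n_1+1}^{A_1}\cdots(k_p)_{n_p+1}^{A_p}}\,z_1^{-k_1}\cdots z_p^{-k_p} =\sum_{t=1}^m c_t(z_1,\dots,z_p)\,\mathrm{La}_{\underline{s}_t}(1/\widehat z_{t,1},\dots,1/\widehat z_{t,q_t}),$$ the series on the left converging absolutely. -/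

import Mathlib

noncomputable section

namespace MultiplePolylog

/-- The index set of the sums: the `q`-tuples of integers `k₁ ≥ k₂ ≥ ⋯ ≥ k_q ≥ 1`.
For `q = 0` it consists of the empty tuple alone. -/
abbrev Index (q : ℕ) : Type := {k : Fin q → ℕ // Antitone k ∧ ∀ i, 1 ≤ k i}

/-- The general term `∏ wᵢ ^ kᵢ / kᵢ ^ sᵢ` of a large multiple polylogarithm, with exponents
`sᵢ ∈ ℤ` of any sign. -/
def laTerm {q : ℕ} (s : Fin q → ℤ) (w : Fin q → ℂ) (k : Index q) : ℂ :=
  ∏ i, w i ^ k.1 i / (k.1 i : ℂ) ^ s i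

/-- The large multiple polylogarithm `La_{s₁,…,s_q}(w₁,…,w_q)`, the sum of `laTerm` over
`k₁ ≥ ⋯ ≥ k_q ≥ 1`. In depth `q = 0` it equals `1`. -/
def La {q : ℕ} (s : Fin q → ℤ) (w : Fin q → ℂ) : ℂ :=
  ∑' k : Index q, laTerm s w k

/-- The weight `∑ max(sᵢ, 0)`. -/
def weight {q : ℕ} (s : Fin q → ℤ) : ℤ :=
  ∑ i, max (s i) 0

/-- Laurent polynomials `ℚ[z₁^{±1}, …, z_p^{±1}]`: the group algebra over `ℚ` of the group `ℤᵖ` of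
exponent vectors. -/
abbrev Laurent (p : ℕ) : Type := AddMonoidAlgebra ℚ (Fin p → ℤ)

/-- The value of a Laurent polynomial at a point `z` (with nonzero coordinates). -/
def Laurent.evalAt {p : ℕ} (z : Fin p → ℂ) (c : Laurent p) : ℂ :=
  c.coeff.sum fun e a => (a : ℂ) * ∏ j, z j ^ e j

/-- The general term
`P(k₁,…,k_p) / ((k₁)_{n₁+1}^{A₁} ⋯ (k_p)_{n_p+1}^{A_p}) · z₁^{-k₁} ⋯ z_p^{-k_p}`,
where `(x)_m = x (x+1) ⋯ (x+m-1)`. -/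
def seriesTerm {p : ℕ} (P : MvPolynomial (Fin p) ℚ) (A n : Fin p → ℕ) (z : Fin p → ℂ)
    (k : Index p) : ℂ :=
  MvPolynomial.aeval (fun j => (k.1 j : ℂ)) P /
      (∏ j, ((ascPochhammer ℂ (n j + 1)).eval (k.1 j : ℂ)) ^ A j) *
    ∏ j, z j ^ (-(k.1 j : ℤ))

end MultiplePolylog

end

open MultiplePolylog

/-!
Over the ring of Laurent polynomials, the truncated sums over `K ≥ k₁ ≥ ⋯ ≥ k_p ≥ 1` are nested sums
of sequences `f(k) u ^ k`, where `u` is a monomial and `f` is a rational function with poles at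
non-positive integers. By partial fractions `f` is a combination of powers `(k + i) ^ (-s)`. A shift
`i > 0` is lowered by Abel summation: replacing `k + 1` by `k` costs a factor `u⁻¹`, a boundary term
at `K`, a constant, and a sum weighted by the increment of the next inner sum. In this last sum the
two outermost indices have merged, so that the depth drops while weights and supports add up. Since
the truncated polylogarithms have increments of the same shape, induction on the depth expands a
nested sum into truncated polylogarithms and boundary terms.

The supports add up to `{1, …, p}` without repetition, which is why only products of distinct `z_j`
occur. The outermost support always contains the index `1`; as `|z₁| > 1`, the boundary terms decay
exponentially and the surviving series converge absolutely. Letting `K → ∞` gives the theorem.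
-/

noncomputable section

namespace MultiplePolylog

open Asymptotics Filter Finset Topology

/-! ### Rational functions with poles at non-positive integers -/

/-- The function `k ↦ (k + i) ^ (-s)` on the integers `k ≥ 1`, written in terms of `m = k - 1`. -/
def shiftedPow (i : ℕ) (s : ℤ) (m : ℕ) : ℚ :=
  ((m : ℚ) + 1 + i) ^ (-s)

/-- The rational functions of `k = m + 1` whose poles are non-positive integers of order at most
`a`. -/
def polar (a : ℕ) : Submodule ℚ (ℕ → ℚ) :=
  Submodule.span ℚ {f | ∃ (i : ℕ) (s : ℤ), s ≤ a ∧ f = shiftedPow i s}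

lemma shiftedPow_mem_polar {a : ℕ} (i : ℕ) {s : ℤ} (hs : s ≤ a) : shiftedPow i s ∈ polar a :=
  Submodule.subset_span ⟨i, s, hs, rfl⟩

lemma map_mem_of_mem_polar {M : Type*} [AddCommGroup M] [Module ℚ M] {N : Submodule ℚ M} {a : ℕ}
    (T : (ℕ → ℚ) →ₗ[ℚ] M) (h : ∀ (i : ℕ) (s : ℤ), s ≤ a → T (shiftedPow i s) ∈ N) {f : ℕ → ℚ}
    (hf : f ∈ polar a) : T f ∈ N := by
  suffices polar a ≤ N.comap T from this hf
  refine Submodule.span_le.2 ?_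
  rintro _ ⟨i, s, hs, rfl⟩
  exact h i s hs

lemma polar_mono : Monotone polar := fun a b hab f hf =>
  map_mem_of_mem_polar LinearMap.id (fun i _ hs => shiftedPow_mem_polar i (by omega)) hf

lemma shiftedPow_succ (i : ℕ) (s : ℤ) : shiftedPow (i + 1) s = fun m => shiftedPow i s (m + 1) := by
  ext m
  simp only [shiftedPow]
  push_cast
  ring_nf

lemma comp_succ_mem_polar {a : ℕ} {f : ℕ → ℚ} (hf : f ∈ polar a) :
    (fun m => f (m + 1)) ∈ polar a := by
  refine map_mem_of_mem_polar (LinearMap.funLeft ℚ ℚ (· + 1)) (fun i s hs => ?_) hf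
  change (fun m => shiftedPow i s (m + 1)) ∈ polar a
  exact shiftedPow_succ i s ▸ shiftedPow_mem_polar (i + 1) hs

lemma shiftedPow_zero (i : ℕ) : shiftedPow i 0 = 1 := by
  ext m
  simp [shiftedPow]

lemma shiftedPow_mul_shiftedPow_same (i : ℕ) (s t : ℤ) :
    shiftedPow i s * shiftedPow i t = shiftedPow i (s + t) := by
  ext m
  have : (m : ℚ) + 1 + i ≠ 0 := by positivity
  simp only [shiftedPow, Pi.mul_apply]
  rw [neg_add, zpow_add₀ this]

lemma shiftedPow_neg_one_eq (i j : ℕ) :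
    shiftedPow j (-1) = shiftedPow i (-1) + ((j : ℚ) - i) • (1 : ℕ → ℚ) := by
  ext m
  simp [shiftedPow]

lemma partial_fraction {i j : ℕ} (hij : i ≠ j) (s : ℤ) :
    shiftedPow j 1 * shiftedPow i s =
      ((i : ℚ) - j)⁻¹ • (shiftedPow j 1 * shiftedPow i (s - 1) - shiftedPow i s) := by
  have hij' : (i : ℚ) - j ≠ 0 := sub_ne_zero.2 (by exact_mod_cast hij)
  ext m
  have hi : (m : ℚ) + 1 + i ≠ 0 := by positivity
  have hj : (m : ℚ) + 1 + j ≠ 0 := by positivity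
  simp only [shiftedPow, Pi.mul_apply, Pi.smul_apply, Pi.sub_apply, smul_eq_mul]
  rw [show -(s - 1) = -s + 1 by ring, zpow_add_one₀ hi, zpow_neg_one]
  field_simp
  ring

lemma linear_pow_mul_mem_polar {a : ℕ} (j l : ℕ) {f : ℕ → ℚ} (hf : f ∈ polar a) :
    shiftedPow j (-l) * f ∈ polar a := by
  induction l with
  | zero => simpa [shiftedPow_zero] using hf
  | succ l ih =>
    rw [Nat.cast_succ, neg_add, add_comm, ← shiftedPow_mul_shiftedPow_same, mul_assoc]
    refine map_mem_of_mem_polar (LinearMap.mulLeft ℚ (shiftedPow j (-1))) (fun i s hs => ?_) ih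
    rw [LinearMap.mulLeft_apply, shiftedPow_neg_one_eq i j, add_mul, smul_one_mul,
      shiftedPow_mul_shiftedPow_same]
    exact add_mem (shiftedPow_mem_polar i (by omega))
      (Submodule.smul_mem _ _ (shiftedPow_mem_polar i hs))

lemma inv_mul_shiftedPow_mem_polar {i j : ℕ} (hij : i ≠ j) {a : ℕ} {s : ℤ} (hs : s ≤ a) :
    shiftedPow j 1 * shiftedPow i s ∈ polar (max a 1) := by
  induction a generalizing s with
  | zero =>
    obtain ⟨l, rfl⟩ := Int.exists_eq_neg_ofNat hs
    rw [mul_comm]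
    exact linear_pow_mul_mem_polar i l (shiftedPow_mem_polar j (by simp))
  | succ a ih =>
    rw [partial_fraction hij]
    refine Submodule.smul_mem _ _ (sub_mem ?_ (shiftedPow_mem_polar i (by omega)))
    exact polar_mono (by omega) (ih (by omega))

lemma inv_mul_mem_polar {a : ℕ} (j : ℕ) {f : ℕ → ℚ} (hf : f ∈ polar a) :
    shiftedPow j 1 * f ∈ polar (a + 1) := by
  refine map_mem_of_mem_polar (LinearMap.mulLeft ℚ (shiftedPow j 1)) (fun i s hs => ?_) hf
  rw [LinearMap.mulLeft_apply]
  obtain rfl | hij := eq_or_ne i j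
  · rw [shiftedPow_mul_shiftedPow_same]
    exact shiftedPow_mem_polar i (by omega)
  · exact polar_mono (by omega) (inv_mul_shiftedPow_mem_polar hij hs)

lemma inv_pow_mul_mem_polar {a : ℕ} (j l : ℕ) {f : ℕ → ℚ} (hf : f ∈ polar a) :
    shiftedPow j l * f ∈ polar (a + l) := by
  induction l with
  | zero => simpa [shiftedPow_zero] using hf
  | succ l ih =>
    rw [Nat.cast_succ, add_comm (l : ℤ), ← shiftedPow_mul_shiftedPow_same, mul_assoc]
    exact inv_mul_mem_polar j ih

lemma mul_mem_polar {a b : ℕ} {f g : ℕ → ℚ} (hf : f ∈ polar a) (hg : g ∈ polar b) :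
    f * g ∈ polar (a + b) := by
  refine map_mem_of_mem_polar (LinearMap.mulLeft ℚ f) (fun j s hs => ?_) hg
  rw [LinearMap.mulLeft_apply, mul_comm]
  obtain ⟨l, rfl | rfl⟩ := s.eq_nat_or_neg
  · exact polar_mono (by omega) (inv_pow_mul_mem_polar j l hf)
  · exact polar_mono (by omega) (linear_pow_mul_mem_polar j l hf)

lemma pow_mem_polar {a : ℕ} {f : ℕ → ℚ} (hf : f ∈ polar a) (l : ℕ) : f ^ l ∈ polar (l * a) := by
  induction l with
  | zero => simpa [shiftedPow_zero] using shiftedPow_mem_polar (a := 0) 0 le_rfl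
  | succ l ih =>
    rw [pow_succ, Nat.succ_mul]
    exact mul_mem_polar ih hf

/-- The function `1 / (k)_{n+1}` of `k = m + 1`. -/
def invPochhammer (n m : ℕ) : ℚ :=
  ((ascPochhammer ℚ (n + 1)).eval ((m : ℚ) + 1))⁻¹

lemma invPochhammer_succ (n : ℕ) :
    invPochhammer (n + 1) =
      ((n : ℚ) + 1)⁻¹ • (invPochhammer n - fun m => invPochhammer n (m + 1)) := by
  ext m
  have hn : (n : ℚ) + 1 ≠ 0 := by positivity
  have hk : (m : ℚ) + 1 ≠ 0 := by positivity
  have hkn : (m : ℚ) + 1 + 1 + n ≠ 0 := by positivity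
  have hpos : 0 < (ascPochhammer ℚ n).eval ((m : ℚ) + 1 + 1) :=
    ascPochhammer_pos n _ (by positivity)
  have hleft (l : ℕ) : (ascPochhammer ℚ (l + 1)).eval ((m : ℚ) + 1) =
      (m + 1) * (ascPochhammer ℚ l).eval ((m : ℚ) + 1 + 1) := by
    simp [ascPochhammer_succ_left]
  simp only [invPochhammer, Pi.smul_apply, Pi.sub_apply, smul_eq_mul, hleft, Nat.cast_succ,
    ascPochhammer_succ_eval]
  field_simp
  ring

lemma invPochhammer_mem_polar (n : ℕ) : invPochhammer n ∈ polar 1 := by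
  induction n with
  | zero =>
    convert shiftedPow_mem_polar (a := 1) 0 (s := 1) (by simp) using 1
    ext m
    simp [invPochhammer, shiftedPow]
  | succ n ih =>
    rw [invPochhammer_succ]
    exact Submodule.smul_mem _ _ (sub_mem ih (comp_succ_mem_polar ih))

lemma pow_mul_invPochhammer_pow_mem_polar (l n A : ℕ) :
    shiftedPow 0 (-l) * invPochhammer n ^ A ∈ polar A := by
  simpa using linear_pow_mul_mem_polar 0 l (pow_mem_polar (invPochhammer_mem_polar n) A)

/-! ### Nested sums -/

section NestedSum

variable {R : Type*}

/-- The nested sum `∑ g₁(k₁ - 1) ⋯ g_q(k_q - 1)` over `K ≥ k₁ ≥ ⋯ ≥ k_q ≥ 1`, where the `gᵢ` are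
the entries of the list. -/
def nestedSum [Semiring R] : List (ℕ → R) → ℕ → R
  | [], _ => 1
  | g :: L, K => ∑ m ∈ range K, g m * nestedSum L (m + 1)

lemma nestedSum_nil [Semiring R] : nestedSum ([] : List (ℕ → R)) = 1 := rfl

lemma nestedSum_cons_succ [Semiring R] (g : ℕ → R) (L : List (ℕ → R)) (m : ℕ) :
    nestedSum (g :: L) (m + 1) = nestedSum (g :: L) m + g m * nestedSum L (m + 1) :=
  sum_range_succ _ _

lemma map_nestedSum {S F : Type*} [Semiring R] [Semiring S] [FunLike F R S] [RingHomClass F R S]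
    (φ : F) (L : List (ℕ → R)) (K : ℕ) :
    φ (nestedSum L K) = nestedSum (L.map fun g m => φ (g m)) K := by
  induction L generalizing K with
  | nil => simp [nestedSum]
  | cons g L ih => simp [nestedSum, ih]

lemma antitone_cons_iff {q : ℕ} (a : ℕ) (k : Fin q → ℕ) :
    Antitone (Fin.cons a k : Fin (q + 1) → ℕ) ↔ (∀ i, k i ≤ a) ∧ Antitone k := by
  simp [Antitone, Fin.forall_fin_succ]

/-- The tuples `K ≥ k₁ ≥ ⋯ ≥ k_q ≥ 1`. -/
def truncation (q K : ℕ) : Finset (Index q) :=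
  open Classical in
  (Fintype.piFinset fun _ => Icc 1 K).subtype fun k => Antitone k ∧ ∀ i, 1 ≤ k i

lemma mem_truncation {q K : ℕ} {k : Index q} : k ∈ truncation q K ↔ ∀ i, k.1 i ≤ K := by
  simp [truncation, k.2.2]

lemma tendsto_truncation (q : ℕ) : Tendsto (truncation q) atTop atTop :=
  tendsto_atTop_finset_of_monotone
    (fun _ _ h _ hk => mem_truncation.2 fun i => (mem_truncation.1 hk i).trans h)
    fun k => ⟨∑ i, k.1 i, mem_truncation.2 fun i =>
      single_le_sum (f := k.1) (fun _ _ => Nat.zero_le _) (mem_univ i)⟩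

lemma sum_truncation_succ [AddCommMonoid R] {q : ℕ} (F : (Fin (q + 1) → ℕ) → R) (K : ℕ) :
    ∑ k ∈ truncation (q + 1) K, F k.1 =
      ∑ m ∈ range K, ∑ k ∈ truncation q (m + 1), F (Fin.cons (m + 1) k.1) := by
  rw [sum_sigma']
  symm
  refine sum_bij' (fun x hx => ⟨Fin.cons (x.1 + 1) x.2.1, ?_, ?_⟩)
    (fun k _ => ⟨k.1 0 - 1, Fin.tail k.1, ?_, fun i => k.2.2 i.succ⟩) ?_ ?_ ?_ ?_ ?_
  · exact (antitone_cons_iff _ _).2 ⟨mem_truncation.1 (mem_sigma.1 hx).2, x.2.2.1⟩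
  · exact Fin.cases (Nat.succ_pos _) x.2.2.2
  · exact fun i j hij => k.2.1 (Fin.succ_le_succ_iff.2 hij)
  · intro x hx
    simp only [mem_sigma, mem_range, mem_truncation] at hx
    exact mem_truncation.2 (Fin.cases hx.1 fun i => (hx.2 i).trans hx.1)
  · intro k hk
    have hpos := k.2.2 0
    have hle := mem_truncation.1 hk 0
    simp only [mem_sigma, mem_range, mem_truncation, Nat.sub_add_cancel hpos]
    exact ⟨by omega, fun i => k.2.1 (Fin.zero_le _)⟩
  · exact fun x _ => by simp
  · exact fun k _ => Subtype.ext (by simp [Nat.sub_add_cancel (k.2.2 0)])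
  · exact fun x _ => rfl

lemma sum_truncation [CommSemiring R] {q : ℕ} (g : Fin q → ℕ → R) (K : ℕ) :
    ∑ k ∈ truncation q K, ∏ i, g i (k.1 i - 1) = nestedSum (List.ofFn g) K := by
  induction q generalizing K with
  | zero =>
    have hempty : truncation 0 K = {⟨finZeroElim, fun i => i.elim0, fun i => i.elim0⟩} :=
      eq_singleton_iff_unique_mem.2 ⟨mem_truncation.2 fun i => i.elim0,
        fun k _ => Subtype.ext (Subsingleton.elim _ _)⟩
    simp [hempty, nestedSum]
  | succ q ih =>
    rw [sum_truncation_succ fun k => ∏ i, g i (k i - 1), List.ofFn_succ, nestedSum]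
    simp only [Fin.prod_univ_succ, Fin.cons_zero, Fin.cons_succ, add_tsub_cancel_right, ← mul_sum,
      ih]

end NestedSum

/-! ### Growth of sequences -/

section Growth

variable {E : Type*}

/-- Sequences growing more slowly than every geometric sequence of ratio greater than `1`. This
class is stable under nested summation. -/
def IsSubexponential [Norm E] (g : ℕ → E) : Prop :=
  ∀ ρ : ℝ, 1 < ρ → g =O[atTop] fun m => ρ ^ m

/-- Sequences bounded by a geometric sequence of ratio less than `1`. -/
def HasExpDecay [Norm E] (g : ℕ → E) : Prop :=
  ∃ r : ℝ, 0 < r ∧ r < 1 ∧ g =O[atTop] fun m => r ^ m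

lemma IsSubexponential.norm [SeminormedAddCommGroup E] {g : ℕ → E} (hg : IsSubexponential g) :
    IsSubexponential fun m => ‖g m‖ :=
  fun ρ hρ => (hg ρ hρ).norm_left

lemma HasExpDecay.norm [SeminormedAddCommGroup E] {g : ℕ → E} (hg : HasExpDecay g) :
    HasExpDecay fun m => ‖g m‖ :=
  let ⟨r, hr0, hr1, h⟩ := hg
  ⟨r, hr0, hr1, h.norm_left⟩

lemma IsSubexponential.of_isBigO_one [Norm E] {g : ℕ → E} (hg : g =O[atTop] fun _ => (1 : ℝ)) :
    IsSubexponential g := fun ρ hρ =>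
  hg.trans <| .of_norm_le fun m => by simpa using one_le_pow₀ hρ.le

lemma IsSubexponential.add [SeminormedAddCommGroup E] {f g : ℕ → E} (hf : IsSubexponential f)
    (hg : IsSubexponential g) : IsSubexponential (f + g) :=
  fun ρ hρ => (hf ρ hρ).add (hg ρ hρ)

lemma IsSubexponential.mul [SeminormedRing E] {f g : ℕ → E} (hf : IsSubexponential f)
    (hg : IsSubexponential g) : IsSubexponential (f * g) := by
  intro ρ hρ
  have hsqrt : 1 < √ρ := by rwa [Real.lt_sqrt zero_le_one, one_pow]
  refine ((hf _ hsqrt).mul (hg _ hsqrt)).congr_right fun m => ?_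
  rw [← mul_pow, Real.mul_self_sqrt (by positivity)]

lemma HasExpDecay.mul_isSubexponential [SeminormedRing E] {f g : ℕ → E} (hf : HasExpDecay f)
    (hg : IsSubexponential g) : HasExpDecay (f * g) := by
  obtain ⟨r, hr0, hr1, hfr⟩ := hf
  obtain ⟨ρ, hρ1, hρr⟩ := exists_between ((one_lt_inv₀ hr0).2 hr1)
  refine ⟨r * ρ, by positivity, ?_, ?_⟩
  · rwa [lt_inv_comm₀ (by positivity) hr0, ← one_div, lt_div_iff₀ (by positivity)] at hρr
  · exact (hfr.mul (hg ρ hρ1)).congr_right fun m => (mul_pow _ _ _).symm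

lemma IsSubexponential.comp_succ [Norm E] {g : ℕ → E} (hg : IsSubexponential g) :
    IsSubexponential fun m => g (m + 1) := fun ρ hρ =>
  ((hg ρ hρ).comp_tendsto (tendsto_add_atTop_nat 1)).trans <|
    .of_bound ρ (.of_forall fun m => by simp [pow_succ', abs_of_pos (zero_lt_one.trans hρ)])

lemma IsSubexponential.sum_range [SeminormedAddCommGroup E] {g : ℕ → E}
    (hg : IsSubexponential g) : IsSubexponential fun K => ∑ m ∈ range K, g m := by
  intro ρ hρ
  have hρ0 : 0 < ρ := zero_lt_one.trans hρ
  obtain ⟨C, hC, hbound⟩ := bound_of_isBigO_nat_atTop (hg ρ hρ)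
  refine .of_bound (C / (ρ - 1)) (.of_forall fun K => ?_)
  calc ‖∑ m ∈ range K, g m‖ ≤ ∑ m ∈ range K, C * ρ ^ m :=
        norm_sum_le_of_le _ fun m _ => by
          simpa [abs_of_pos hρ0] using hbound (x := m) (by positivity)
    _ = C * ((ρ ^ K - 1) / (ρ - 1)) := by rw [← mul_sum, geom_sum_eq hρ.ne']
    _ ≤ C / (ρ - 1) * ‖ρ ^ K‖ := by
        rw [Real.norm_of_nonneg (by positivity), mul_div_assoc', div_mul_eq_mul_div]
        have : 0 < ρ - 1 := sub_pos.2 hρ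
        gcongr
        linarith

lemma IsSubexponential.nestedSum [SeminormedRing E] {L : List (ℕ → E)}
    (hL : ∀ g ∈ L, IsSubexponential g) : IsSubexponential (nestedSum L) := by
  induction L with
  | nil => exact .of_isBigO_one (isBigO_const_const _ one_ne_zero _)
  | cons g L ih =>
    rw [List.forall_mem_cons] at hL
    exact (hL.1.mul (ih hL.2).comp_succ).sum_range

lemma HasExpDecay.tendsto_zero [NormedAddCommGroup E] {g : ℕ → E} (hg : HasExpDecay g) :
    Tendsto g atTop (𝓝 0) :=
  let ⟨_, hr0, hr1, h⟩ := hg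
  h.trans_tendsto (tendsto_pow_atTop_nhds_zero_of_lt_one hr0.le hr1)

lemma HasExpDecay.summable [SeminormedAddCommGroup E] [CompleteSpace E] {g : ℕ → E}
    (hg : HasExpDecay g) : Summable g :=
  let ⟨_, hr0, hr1, h⟩ := hg
  summable_of_isBigO_nat (summable_geometric_of_lt_one hr0.le hr1) h

lemma summable_prod_index [NormedField E] [CompleteSpace E] {q : ℕ} {g : Fin q → ℕ → E}
    (h0 : ∀ i : Fin q, i.val = 0 → HasExpDecay (g i)) (hg : ∀ i, IsSubexponential (g i)) :
    Summable fun k : Index q => ∏ i, g i (k.1 i - 1) := by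
  obtain _ | q := q
  · exact .of_finite
  have hdecay := (h0 0 rfl).norm.mul_isSubexponential
    (IsSubexponential.nestedSum (L := List.ofFn fun (i : Fin q) m => ‖g i.succ m‖)
      (by simpa [List.mem_ofFn] using fun i : Fin q => (hg i.succ).norm)).comp_succ
  have hsum := hdecay.summable
  refine .of_norm (summable_of_sum_le
    (c := ∑' m, ‖g 0 m‖ * nestedSum (List.ofFn fun (i : Fin q) m => ‖g i.succ m‖) (m + 1))
    (fun _ => norm_nonneg _) fun u => ?_)
  obtain ⟨K, hK⟩ := ((tendsto_truncation (q + 1)).eventually_ge_atTop u).exists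
  calc ∑ k ∈ u, ‖∏ i, g i (k.1 i - 1)‖
      ≤ ∑ k ∈ truncation (q + 1) K, ‖∏ i, g i (k.1 i - 1)‖ :=
        sum_le_sum_of_subset_of_nonneg hK fun _ _ _ => norm_nonneg _
    _ = nestedSum (List.ofFn fun i m => ‖g i m‖) K := by simp only [norm_prod, ← sum_truncation]
    _ ≤ _ := by
      rw [List.ofFn_succ]
      refine hsum.sum_le_tsum (range K) fun m _ => mul_nonneg (norm_nonneg _) ?_
      rw [← sum_truncation]
      positivity

end Growth

/-! ### Summation by parts -/

section SummationByParts

variable {R : Type*} [CommRing R]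

/-- The summation operator `(g, F) ↦ (K ↦ ∑ g(k - 1) F(k))`, the sum being over `1 ≤ k ≤ K`, which
builds up the nested sums. -/
def weightedSum : (ℕ → R) →ₗ[R] (ℕ → R) →ₗ[R] (ℕ → R) :=
  LinearMap.mk₂ R (fun g F K => ∑ m ∈ range K, g m * F (m + 1))
    (fun _ _ _ => by ext; simp [add_mul, sum_add_distrib])
    (fun _ _ _ => by ext; simp [mul_assoc, mul_sum])
    (fun _ _ _ => by ext; simp [mul_add, sum_add_distrib])
    (fun _ _ _ => by ext; simp [mul_left_comm, mul_sum])

lemma weightedSum_apply (g F : ℕ → R) (K : ℕ) :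
    weightedSum g F K = ∑ m ∈ range K, g m * F (m + 1) := rfl

lemma weightedSum_comp_succ {F h E : ℕ → R} (hF : ∀ m, F (m + 1) = F m + h m * E (m + 1))
    (g : ℕ → R) :
    weightedSum (fun m => g (m + 1)) F =
      weightedSum g F - weightedSum (g * h) E + g * F - (g 0 * F 0) • 1 := by
  ext K
  simp only [weightedSum_apply, Pi.add_apply, Pi.sub_apply, Pi.mul_apply, Pi.smul_apply,
    Pi.one_apply, smul_eq_mul, mul_one, ← sum_sub_distrib, mul_assoc, ← mul_sub]
  rw [add_sub_assoc, ← sum_range_sub (fun m => g m * F m), ← sum_add_distrib]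
  refine sum_congr rfl fun m _ => ?_
  rw [hF]
  ring

variable [Algebra ℚ R]

/-- The sequence `f(k) u ^ k` of `k = m + 1`. -/
def twist (u : R) : (ℕ → ℚ) →ₗ[ℚ] (ℕ → R) where
  toFun f m := f m • u ^ (m + 1)
  map_add' f g := by ext; simp [add_smul]
  map_smul' c f := by ext; simp [mul_smul]

lemma twist_apply (u : R) (f : ℕ → ℚ) (m : ℕ) : twist u f m = f m • u ^ (m + 1) := rfl

lemma twist_mul_twist (u w : R) (f h : ℕ → ℚ) : twist u f * twist w h = twist (u * w) (f * h) := by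
  ext m
  simp only [twist_apply, Pi.mul_apply, smul_mul_smul_comm, mul_pow]

lemma twist_succ (u : R) (f : ℕ → ℚ) :
    (fun m => twist u f (m + 1)) = u • twist u fun m => f (m + 1) := by
  ext m
  simp [twist_apply, pow_succ' u (m + 1)]

lemma weightedSum_twist_mul (g : ℕ → R) (u : R) (f : ℕ → ℚ) (F : ℕ → R) :
    weightedSum g (twist u f * F) = u • weightedSum (g * twist u fun m => f (m + 1)) F := by
  ext K
  have hsucc (m : ℕ) := congrFun (twist_succ u f) m
  simp only [Pi.smul_apply, smul_eq_mul] at hsucc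
  simp only [weightedSum_apply, Pi.mul_apply, Pi.smul_apply, smul_eq_mul, mul_sum, hsucc]
  exact sum_congr rfl fun m _ => by ring

lemma weightedSum_twist_mem {N : Submodule R (ℕ → R)} {u : R} (hu : IsUnit u) {F h E : ℕ → R}
    (hF : ∀ m, F (m + 1) = F m + h m * E (m + 1)) {a : ℕ} (hone : 1 ∈ N)
    (hzero : ∀ s : ℤ, s ≤ a → weightedSum (twist u (shiftedPow 0 s)) F ∈ N)
    (hdiff : ∀ f ∈ polar a, weightedSum (twist u f * h) E ∈ N)
    (hboundary : ∀ f ∈ polar a, twist u f * F ∈ N) {f : ℕ → ℚ} (hf : f ∈ polar a) :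
    weightedSum (twist u f) F ∈ N := by
  refine map_mem_of_mem_polar (N := N.restrictScalars ℚ)
    ((weightedSum.flip F).restrictScalars ℚ ∘ₗ twist u) (fun i s hs => ?_) hf
  change weightedSum (twist u (shiftedPow i s)) F ∈ N
  induction i with
  | zero => exact hzero s hs
  | succ i ih =>
    have hparts := weightedSum_comp_succ hF (twist u (shiftedPow i s))
    rw [twist_succ, ← shiftedPow_succ, map_smul, LinearMap.smul_apply] at hparts
    rw [← N.smul_mem_iff_of_isUnit hu, hparts]
    have hpolar : shiftedPow i s ∈ polar a := shiftedPow_mem_polar i hs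
    exact sub_mem (add_mem (sub_mem ih (hdiff _ hpolar)) (hboundary _ hpolar))
      (N.smul_mem _ hone)

end SummationByParts

/-! ### Reduction to polylogarithmic words -/

section Word

variable {R ι : Type*} [CommRing R] [Algebra ℚ R]

/-- A letter `(s, S)` stands for the sequence `k ↦ k ^ (-s) x_S ^ k`, where `x_S` is the
product of the `x_i` for `i ∈ S`. -/
def letterSeq (x : ι → R) (a : ℤ × Multiset ι) : ℕ → R :=
  twist (a.2.map x).prod (shiftedPow 0 a.1)

/-- The truncated multiple polylogarithm attached to a word. -/
def polylogSum (x : ι → R) (L : List (ℤ × Multiset ι)) : ℕ → R :=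
  nestedSum (L.map (letterSeq x))

/-- The depth, the weight and the total support of a word. Degrees are compared componentwise, so
that the bound `wordDegree L ≤ (p, _, univ.val)` forces the supports of the letters to be sets. -/
def wordDegree (L : List (ℤ × Multiset ι)) : ℕ × ℕ × Multiset ι :=
  (L.map fun a => (1, a.1.toNat, a.2)).sum

/-- The span of the truncated multiple polylogarithms of degree at most `D` whose letters have
nonempty support and whose first letter has a support containing `v`. -/
def polylogSpan (x : ι → R) (D : ℕ × ℕ × Multiset ι) (v : Multiset ι) : Submodule R (ℕ → R) :=
  Submodule.span R {F | ∃ L : List (ℤ × Multiset ι), (∀ a ∈ L, a.2 ≠ 0) ∧ wordDegree L ≤ D ∧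
    (∀ a ∈ L.head?, v ≤ a.2) ∧ F = polylogSum x L}

/-- The span of the boundary terms `f(K + 1) x_S ^ (K + 1) F(K)` of summations by parts, where `F`
is a truncated multiple polylogarithm and `S` contains `v`; a pole of order `a` counts as a letter
`(a, S)` for the degree. -/
def boundarySpan (x : ι → R) (D : ℕ × ℕ × Multiset ι) (v : Multiset ι) : Submodule R (ℕ → R) :=
  Submodule.span R {F | ∃ (a : ℕ) (f : ℕ → ℚ) (S : Multiset ι) (L : List (ℤ × Multiset ι)),
    f ∈ polar a ∧ v ≤ S ∧ (∀ b ∈ L, b.2 ≠ 0) ∧ (1, a, S) + wordDegree L ≤ D ∧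
    F = twist (S.map x).prod f * polylogSum x L}

/-- The span in which nested sums of rational functions are expanded: truncated multiple
polylogarithms and boundary terms. -/
def nestSpan (x : ι → R) (D : ℕ × ℕ × Multiset ι) (v : Multiset ι) : Submodule R (ℕ → R) :=
  polylogSpan x D v ⊔ boundarySpan x D v

lemma wordDegree_cons (a : ℤ × Multiset ι) (L : List (ℤ × Multiset ι)) :
    wordDegree (a :: L) = (1, a.1.toNat, a.2) + wordDegree L := by
  simp [wordDegree]

lemma polylogSum_cons (x : ι → R) (a : ℤ × Multiset ι) (L : List (ℤ × Multiset ι)) :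
    polylogSum x (a :: L) = weightedSum (letterSeq x a) (polylogSum x L) := rfl

lemma nestSpan_mono (x : ι → R) {D D' : ℕ × ℕ × Multiset ι} {v v' : Multiset ι} (hD : D ≤ D')
    (hv : v' ≤ v) : nestSpan x D v ≤ nestSpan x D' v' := by
  refine sup_le_sup (Submodule.span_mono ?_) (Submodule.span_mono ?_)
  · rintro _ ⟨L, hL, hdeg, hhead, rfl⟩
    exact ⟨L, hL, hdeg.trans hD, fun a ha => hv.trans (hhead a ha), rfl⟩
  · rintro _ ⟨a, f, S, L, hf, hS, hL, hdeg, rfl⟩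
    exact ⟨a, f, S, L, hf, hv.trans hS, hL, hdeg.trans hD, rfl⟩

lemma polylogSum_mem_nestSpan (x : ι → R) {D : ℕ × ℕ × Multiset ι} {v : Multiset ι}
    {L : List (ℤ × Multiset ι)} (hL : ∀ a ∈ L, a.2 ≠ 0) (hdeg : wordDegree L ≤ D)
    (hhead : ∀ a ∈ L.head?, v ≤ a.2) : polylogSum x L ∈ nestSpan x D v :=
  le_sup_left (a := polylogSpan x D v) (Submodule.subset_span ⟨L, hL, hdeg, hhead, rfl⟩)

lemma one_mem_nestSpan (x : ι → R) (D : ℕ × ℕ × Multiset ι) (v : Multiset ι) :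
    1 ∈ nestSpan x D v :=
  polylogSum_mem_nestSpan x (L := []) (by simp) (by simp [wordDegree]) (by simp)

lemma weightedSum_twist_shiftedPow_zero_mem_nestSpan (x : ι → R) {L : List (ℤ × Multiset ι)}
    (hL : ∀ b ∈ L, b.2 ≠ 0) {S : Multiset ι} (hS : S ≠ 0) {a : ℕ} {s : ℤ} (hs : s ≤ a) :
    weightedSum (twist (S.map x).prod (shiftedPow 0 s)) (polylogSum x L) ∈
      nestSpan x ((1, a, S) + wordDegree L) S := by
  have hdeg : ((1, s.toNat, S) : ℕ × ℕ × Multiset ι) ≤ (1, a, S) :=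
    Prod.mk_le_mk.2 ⟨le_rfl, Prod.mk_le_mk.2 ⟨Int.toNat_le.2 hs, le_rfl⟩⟩
  rw [← letterSeq.eq_1 x (s, S), ← polylogSum_cons]
  refine polylogSum_mem_nestSpan x (List.forall_mem_cons.2 ⟨hS, hL⟩) ?_ (by simp)
  rw [wordDegree_cons]
  gcongr

lemma twist_mul_polylogSum_mem_nestSpan (x : ι → R) {L : List (ℤ × Multiset ι)}
    (hL : ∀ b ∈ L, b.2 ≠ 0) (S : Multiset ι) {a : ℕ} {f : ℕ → ℚ} (hf : f ∈ polar a) :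
    twist (S.map x).prod f * polylogSum x L ∈ nestSpan x ((1, a, S) + wordDegree L) S :=
  Submodule.mem_sup_right (Submodule.subset_span ⟨a, f, S, L, hf, le_rfl, hL, le_rfl, rfl⟩)

lemma merge_letters_le (a b : ℕ) (S T : Multiset ι) :
    ((1, a + b, S + T) : ℕ × ℕ × Multiset ι) ≤ (1, a, S) + (1, b, T) :=
  Prod.mk_le_mk.2 ⟨by simp, le_rfl⟩

lemma weightedSum_twist_polylogSum_mem_nestSpan {x : ι → R} (hx : ∀ i, IsUnit (x i)) {a : ℕ}
    {S : Multiset ι} (hS : S ≠ 0) {f : ℕ → ℚ} (hf : f ∈ polar a) {L : List (ℤ × Multiset ι)}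
    (hL : ∀ b ∈ L, b.2 ≠ 0) :
    weightedSum (twist (S.map x).prod f) (polylogSum x L) ∈
      nestSpan x ((1, a, S) + wordDegree L) S := by
  have hunit (S : Multiset ι) : IsUnit (S.map x).prod := by
    simpa [IsUnit.multisetProd_iff] using fun i _ => hx i
  induction L generalizing a S f with
  | nil =>
    exact weightedSum_twist_mem (hunit S) (h := 0) (E := 0) (by simp [polylogSum, nestedSum_nil])
      (one_mem_nestSpan x _ _)
      (fun s => weightedSum_twist_shiftedPow_zero_mem_nestSpan x hL hS) (fun _ _ => by simp)
      (fun f => twist_mul_polylogSum_mem_nestSpan x hL S) hf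
  | cons b L ih =>
    refine weightedSum_twist_mem (hunit S) (nestedSum_cons_succ _ _) (one_mem_nestSpan x _ _)
      (fun s => weightedSum_twist_shiftedPow_zero_mem_nestSpan x hL hS) (fun f hf => ?_)
      (fun f => twist_mul_polylogSum_mem_nestSpan x hL S) hf
    have hb : shiftedPow 0 b.1 ∈ polar b.1.toNat := shiftedPow_mem_polar 0 b.1.self_le_toNat
    have hdeg : (1, a + b.1.toNat, S + b.2) + wordDegree L ≤
        (1, a, S) + wordDegree (b :: L) := by
      rw [wordDegree_cons, ← add_assoc]
      gcongr
      exact merge_letters_le a _ S _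
    rw [letterSeq, twist_mul_twist, ← Multiset.prod_add, ← Multiset.map_add]
    exact nestSpan_mono x hdeg (Multiset.le_add_right S b.2)
      (ih (by simp [hS]) (mul_mem_polar hf hb) (List.forall_mem_cons.1 hL).2)

lemma weightedSum_twist_mem_nestSpan {x : ι → R} (hx : ∀ i, IsUnit (x i)) {a : ℕ}
    {S : Multiset ι} (hS : S ≠ 0) {f : ℕ → ℚ} (hf : f ∈ polar a) {D : ℕ × ℕ × Multiset ι}
    {v : Multiset ι} {F : ℕ → R} (hF : F ∈ nestSpan x D v) :
    weightedSum (twist (S.map x).prod f) F ∈ nestSpan x ((1, a, S) + D) S := by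
  suffices nestSpan x D v ≤ (nestSpan x ((1, a, S) + D) S).comap (weightedSum (twist _ f)) from
    this hF
  refine sup_le (Submodule.span_le.2 ?_) (Submodule.span_le.2 ?_)
  · rintro _ ⟨L, hL, hdeg, -, rfl⟩
    exact nestSpan_mono x (by gcongr) le_rfl
      (weightedSum_twist_polylogSum_mem_nestSpan hx hS hf hL)
  · rintro _ ⟨b, g, T, L, hg, -, hL, hdeg, rfl⟩
    rw [SetLike.mem_coe, Submodule.mem_comap, weightedSum_twist_mul, twist_mul_twist,
      ← Multiset.prod_add, ← Multiset.map_add]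
    refine Submodule.smul_mem _ _ (nestSpan_mono x ?_ (Multiset.le_add_right S T)
      (weightedSum_twist_polylogSum_mem_nestSpan hx (by simp [hS])
        (mul_mem_polar hf (comp_succ_mem_polar hg)) hL))
    refine le_trans ?_ (add_le_add_right hdeg (1, a, S))
    rw [← add_assoc]
    gcongr
    exact merge_letters_le a b S T

lemma nestedSum_twist_mem_nestSpan {x : ι → R} (hx : ∀ i, IsUnit (x i)) {f : ι → ℕ → ℚ}
    {a : ι → ℕ} (hf : ∀ i, f i ∈ polar (a i)) (l : List ι) {v : Multiset ι}
    (hv : ∀ i ∈ l.head?, v ≤ {i}) :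
    nestedSum (l.map fun i => twist (x i) (f i)) ∈
      nestSpan x (l.map fun i => (1, a i, {i})).sum v := by
  induction l generalizing v with
  | nil => exact one_mem_nestSpan x _ _
  | cons i l ih =>
    have h := weightedSum_twist_mem_nestSpan hx (Multiset.singleton_ne_zero i) (hf i)
      (ih (v := 0) fun _ _ => Multiset.zero_le _)
    rw [Multiset.map_singleton, Multiset.prod_singleton] at h
    exact nestSpan_mono x le_rfl (hv i rfl) h

end Word

/-! ### Evaluation and limits -/

section Evaluation

variable {R S ι E : Type*} [CommRing R] [Algebra ℚ R] [CommRing S] [Algebra ℚ S] [NormedField E]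

lemma norm_prod_map_le_one {x : ι → E} (hx : ∀ i, ‖x i‖ ≤ 1) (S : Multiset ι) :
    ‖(S.map x).prod‖ ≤ 1 := by
  refine Multiset.prod_induction (fun y => ‖y‖ ≤ 1) _ (fun a b ha hb => ?_) (by simp) ?_
  · simpa using mul_le_one₀ ha (norm_nonneg _) hb
  · exact Multiset.forall_mem_map_iff.2 fun i _ => hx i

lemma norm_prod_map_lt_one {x : ι → E} (hx : ∀ i, ‖x i‖ ≤ 1) {i₀ : ι} (hi₀ : ‖x i₀‖ < 1)
    {S : Multiset ι} (hS : {i₀} ≤ S) : ‖(S.map x).prod‖ < 1 := by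
  obtain ⟨T, rfl⟩ := Multiset.le_iff_exists_add.1 hS
  rw [Multiset.map_add, Multiset.prod_add, Multiset.map_singleton, Multiset.prod_singleton,
    norm_mul]
  exact mul_lt_one_of_nonneg_of_lt_one_left (norm_nonneg _) hi₀ (norm_prod_map_le_one hx T)

variable [NormedAlgebra ℚ E]

lemma map_twist (φ : R →ₐ[ℚ] S) (u : R) (f : ℕ → ℚ) (m : ℕ) :
    φ (twist u f m) = twist (φ u) f m := by
  simp [twist_apply]

lemma map_polylogSum (φ : R →ₐ[ℚ] S) (x : ι → R) (L : List (ℤ × Multiset ι)) (K : ℕ) :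
    φ (polylogSum x L K) = polylogSum (fun i => φ (x i)) L K := by
  have hletter (a : ℤ × Multiset ι) :
      (fun m => φ (letterSeq x a m)) = letterSeq (fun i => φ (x i)) a := by
    ext m
    simp [letterSeq, map_twist, map_multiset_prod]
  rw [polylogSum, map_nestedSum, List.map_map, polylogSum]
  exact congrFun (congrArg nestedSum (List.map_congr_left fun a _ => hletter a)) K

lemma isSubexponential_shiftedPow (i : ℕ) (s : ℤ) : IsSubexponential (shiftedPow i s) := by
  have hpow : IsSubexponential fun m : ℕ => (m : ℚ) ^ (-s) := by
    obtain ⟨l, rfl | rfl⟩ := s.eq_nat_or_neg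
    · refine .of_isBigO_one (.of_bound 1 (.of_forall fun m => ?_))
      simpa [← Rat.norm_cast_real] using Nat.cast_inv_le_one (α := ℝ) (m ^ l)
    · intro ρ hρ
      simpa using (isLittleO_pow_const_const_pow_of_one_lt l hρ).isBigO
  induction i with
  | zero =>
    convert hpow.comp_succ using 2 with m
    simp [shiftedPow]
  | succ i ih => exact shiftedPow_succ i s ▸ ih.comp_succ

lemma isSubexponential_of_mem_polar {a : ℕ} {f : ℕ → ℚ} (hf : f ∈ polar a) :
    IsSubexponential f := by
  induction hf using Submodule.span_induction with
  | mem f hf =>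
    obtain ⟨i, s, -, rfl⟩ := hf
    exact isSubexponential_shiftedPow i s
  | zero => exact fun _ _ => isBigO_zero _ _
  | add f g _ _ hf hg => exact hf.add hg
  | smul c f _ hf => exact fun ρ hρ => (hf ρ hρ).const_smul_left c

lemma IsSubexponential.twist {u : E} (hu : ‖u‖ ≤ 1) {f : ℕ → ℚ} (hf : IsSubexponential f) :
    IsSubexponential (twist u f) := fun ρ hρ =>
  .trans (.of_bound 1 <| .of_forall fun m => by
    rw [twist_apply, norm_smul, norm_pow, one_mul]
    exact mul_le_of_le_one_right (norm_nonneg _) (pow_le_one₀ (norm_nonneg _) hu)) (hf ρ hρ)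

lemma HasExpDecay.twist {u : E} (hu : ‖u‖ < 1) {f : ℕ → ℚ} (hf : IsSubexponential f) :
    HasExpDecay (twist u f) := by
  have hgeom : HasExpDecay (MultiplePolylog.twist u 1) := by
    obtain ⟨r, hur, hr⟩ := exists_between hu
    have hr0 : 0 < r := (norm_nonneg u).trans_lt hur
    refine ⟨r, hr0, hr, .of_bound r (.of_forall fun m => ?_)⟩
    simp only [twist_apply, Pi.one_apply, one_smul, norm_pow, Real.norm_of_nonneg hr0.le,
      ← pow_succ']
    gcongr
  rw [← mul_one u, ← one_mul f, ← twist_mul_twist]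
  exact hgeom.mul_isSubexponential (hf.twist (by simp))

lemma isSubexponential_letterSeq {x : ι → E} (hx : ∀ i, ‖x i‖ ≤ 1) (a : ℤ × Multiset ι) :
    IsSubexponential (letterSeq x a) :=
  (isSubexponential_shiftedPow 0 a.1).twist (norm_prod_map_le_one hx a.2)

lemma isSubexponential_polylogSum {x : ι → E} (hx : ∀ i, ‖x i‖ ≤ 1) (L : List (ℤ × Multiset ι)) :
    IsSubexponential (polylogSum x L) :=
  .nestedSum (List.forall_mem_map.2 fun a _ => isSubexponential_letterSeq hx a)

lemma tendsto_zero_of_mem_boundarySpan (φ : R →ₐ[ℚ] E) {x : ι → R} (hx : ∀ i, ‖φ (x i)‖ ≤ 1)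
    {i₀ : ι} (hi₀ : ‖φ (x i₀)‖ < 1) {D : ℕ × ℕ × Multiset ι} {F : ℕ → R}
    (hF : F ∈ boundarySpan x D {i₀}) : Tendsto (fun K => φ (F K)) atTop (𝓝 0) := by
  induction hF using Submodule.span_induction with
  | mem F hF =>
    obtain ⟨a, f, S, L, hf, hS, -, -, rfl⟩ := hF
    have hdecay : HasExpDecay (twist (S.map fun i => φ (x i)).prod f) :=
      .twist (norm_prod_map_lt_one hx hi₀ hS) (isSubexponential_of_mem_polar hf)
    refine (hdecay.mul_isSubexponential (isSubexponential_polylogSum hx L)).tendsto_zero.congr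
      fun K => ?_
    simp [map_twist, map_polylogSum, map_multiset_prod]
  | zero => simp
  | add F G _ _ hF hG => simpa using hF.add hG
  | smul c F _ hF => simpa using hF.const_mul (φ c)

end Evaluation

lemma hasSum_of_tendsto_truncation {M : Type*} [AddCommMonoid M] [TopologicalSpace M] [T2Space M]
    {q : ℕ} {f : Index q → M} (hf : Summable f) {c : M}
    (h : Tendsto (fun K => ∑ k ∈ truncation q K, f k) atTop (𝓝 c)) : HasSum f c := by
  rw [← tendsto_nhds_unique (hf.hasSum.comp (tendsto_truncation q)) h]
  exact hf.hasSum

/-! ### Large multiple polylogarithms -/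

section Polylog

variable {ι : Type*}

/-- The exponents `s_i` of the letters of a word. -/
def exponents (L : List (ℤ × Multiset ι)) (i : Fin L.length) : ℤ :=
  (L.get i).1

/-- The supports `S_i` of the letters of a word, without multiplicities. -/
def supports [DecidableEq ι] (L : List (ℤ × Multiset ι)) (i : Fin L.length) : Finset ι :=
  (L.get i).2.toFinset

lemma length_eq_wordDegree_fst (L : List (ℤ × Multiset ι)) :
    L.length = (wordDegree L).1 := by
  induction L with
  | nil => rfl
  | cons a L ih => simp [wordDegree_cons, ih, add_comm]

lemma weight_exponents (L : List (ℤ × Multiset ι)) :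
    weight (exponents L) = (wordDegree L).2.1 := by
  induction L with
  | nil => rfl
  | cons a L ih =>
    rw [wordDegree_cons, Prod.snd_add, Prod.fst_add, Nat.cast_add, ← ih]
    exact (Fin.sum_univ_succ fun i => max (exponents (a :: L) i) 0).trans
      (congrArg (· + _) (Int.ofNat_toNat a.1).symm)

lemma support_le_wordDegree {L : List (ℤ × Multiset ι)} {a : ℤ × Multiset ι} (ha : a ∈ L) :
    a.2 ≤ (wordDegree L).2.2 := by
  induction L with
  | nil => simp at ha
  | cons b L ih =>
    rw [wordDegree_cons]
    obtain rfl | ha := List.mem_cons.1 ha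
    · exact Multiset.le_add_right _ _
    · exact (ih ha).trans (Multiset.le_add_left _ _)

variable [DecidableEq ι]

lemma laTerm_eq_prod_letterSeq {L : List (ℤ × Multiset ι)} (hL : ∀ a ∈ L, a.2.Nodup)
    (z : ι → ℂ) (k : Index L.length) :
    laTerm (exponents L) (fun i => 1 / ∏ j ∈ supports L i, z j) k =
      ∏ i, letterSeq (fun j => (z j)⁻¹) (L.get i) (k.1 i - 1) := by
  refine prod_congr rfl fun i _ => ?_
  have hk : ((k.1 i - 1 : ℕ) : ℚ) + 1 = k.1 i := by
    exact_mod_cast Nat.sub_add_cancel (k.2.2 i)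
  have hprod : ((L.get i).2.map fun j => (z j)⁻¹).prod = 1 / ∏ j ∈ supports L i, z j := by
    rw [supports, Finset.prod, Multiset.toFinset_val, (hL _ (L.get_mem i)).dedup,
      Multiset.prod_map_inv, one_div]
  rw [letterSeq, twist_apply, hprod, shiftedPow, Nat.cast_zero, add_zero, hk,
    Nat.sub_add_cancel (k.2.2 i), Rat.smul_def]
  push_cast
  rw [zpow_neg, div_eq_mul_inv, mul_comm, exponents]

lemma summable_laTerm {L : List (ℤ × Multiset ι)} (hL : ∀ a ∈ L, a.2.Nodup) {j₀ : ι}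
    (hhead : ∀ a ∈ L.head?, {j₀} ≤ a.2) {z : ι → ℂ} (hz₀ : 1 < ‖z j₀‖) (hz : ∀ j, 1 ≤ ‖z j‖) :
    Summable (laTerm (exponents L) fun i => 1 / ∏ j ∈ supports L i, z j) := by
  have hx (j : ι) : ‖(z j)⁻¹‖ ≤ 1 := by simpa using inv_le_one_of_one_le₀ (hz j)
  have hx₀ : ‖(z j₀)⁻¹‖ < 1 := by simpa using inv_lt_one_of_one_lt₀ hz₀
  rw [funext (laTerm_eq_prod_letterSeq hL z)]
  refine summable_prod_index (fun i hi => ?_) fun i => isSubexponential_letterSeq hx _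
  have hmem : L.get i ∈ L.head? := by
    rw [List.head?_eq_getElem?, ← hi]
    simp
  exact .twist (norm_prod_map_lt_one hx hx₀ (hhead _ hmem)) (isSubexponential_shiftedPow 0 _)

lemma tendsto_polylogSum {L : List (ℤ × Multiset ι)} (hL : ∀ a ∈ L, a.2.Nodup)
    {z : ι → ℂ} (h : Summable (laTerm (exponents L) fun i => 1 / ∏ j ∈ supports L i, z j)) :
    Tendsto (polylogSum (fun j => (z j)⁻¹) L) atTop
      (𝓝 (La (exponents L) fun i => 1 / ∏ j ∈ supports L i, z j)) := by
  refine (h.hasSum.comp (tendsto_truncation L.length)).congr fun K => ?_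
  rw [Function.comp_apply, polylogSum, sum_congr rfl fun k _ => laTerm_eq_prod_letterSeq hL z k,
    sum_truncation]
  congr 1
  conv_rhs => rw [← List.ofFn_get L, List.map_ofFn]
  rfl

end Polylog

/-! ### Expansion over the Laurent polynomials -/

section Laurent

variable {p : ℕ}

/-- The indeterminate `z_j⁻¹` of the ring of Laurent polynomials. -/
def invVar (j : Fin p) : Laurent p :=
  .single (-Pi.single j 1) 1

lemma isUnit_invVar (j : Fin p) : IsUnit (invVar j) :=
  .of_mul_eq_one (.single (Pi.single j 1) 1)
    (by simp [invVar, AddMonoidAlgebra.single_mul_single, AddMonoidAlgebra.one_def])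

/-- Evaluation of Laurent polynomials at a point of the torus, as an algebra homomorphism. -/
def evalHom (z : Fin p → ℂˣ) : Laurent p →ₐ[ℚ] ℂ :=
  AddMonoidAlgebra.lift ℚ ℂ (Fin p → ℤ)
    { toFun e := ∏ j, (z j : ℂ) ^ e.toAdd j
      map_one' := by simp
      map_mul' e f := by simp [zpow_add₀, prod_mul_distrib] }

lemma evalHom_apply (z : Fin p → ℂˣ) (c : Laurent p) :
    evalHom z c = c.evalAt fun j => z j := by
  simp [evalHom, Laurent.evalAt, AddMonoidAlgebra.lift_apply, Rat.smul_def]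

lemma evalHom_invVar (z : Fin p → ℂˣ) (j : Fin p) : evalHom z (invVar j) = (z j : ℂ)⁻¹ := by
  rw [evalHom, invVar, AddMonoidAlgebra.lift_single, one_smul]
  change ∏ i, (z i : ℂ) ^ (-Pi.single j 1 : Fin p → ℤ) i = _
  rw [prod_eq_single j (fun i _ hij => by simp [hij]) (by simp)]
  simp

lemma exists_la_expansion {D : ℕ × ℕ × Multiset (Fin p)} (hD : D.2.2.Nodup) {j₀ : Fin p}
    {F : ℕ → Laurent p} (hF : F ∈ nestSpan invVar D {j₀}) :
    ∃ (m : ℕ) (L : Fin m → List (ℤ × Multiset (Fin p))) (c : Fin m → Laurent p),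
      (∀ t, wordDegree (L t) ≤ D ∧ ∀ a ∈ L t, a.2 ≠ 0) ∧
      ∀ z : Fin p → ℂˣ, 1 < ‖(z j₀ : ℂ)‖ → (∀ j, 1 ≤ ‖(z j : ℂ)‖) →
        (∀ t, Summable (laTerm (exponents (L t)) fun i => 1 / ∏ j ∈ supports (L t) i, (z j : ℂ))) ∧
        Tendsto (fun K => evalHom z (F K)) atTop (𝓝 (∑ t,
          (c t).evalAt (fun j => z j) *
            La (exponents (L t)) fun i => 1 / ∏ j ∈ supports (L t) i, (z j : ℂ))) := by
  obtain ⟨G, hG, B, hB, rfl⟩ := Submodule.mem_sup.1 hF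
  obtain ⟨m, c, g, rfl⟩ := Submodule.mem_span_set'.1 hG
  choose L hne hdeg hhead hg using fun t => (g t).2
  refine ⟨m, L, c, fun t => ⟨hdeg t, hne t⟩, fun z hz₀ hz => ?_⟩
  have hnodup (t : Fin m) : ∀ a ∈ L t, a.2.Nodup := fun a ha =>
    Multiset.nodup_of_le ((support_le_wordDegree ha).trans (hdeg t).2.2) hD
  have hsum (t : Fin m) := summable_laTerm (hnodup t) (hhead t) hz₀ hz
  refine ⟨hsum, ?_⟩
  have hB0 : Tendsto (fun K => evalHom z (B K)) atTop (𝓝 0) := by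
    refine tendsto_zero_of_mem_boundarySpan (evalHom z) (fun j => ?_) ?_ hB
    · simpa [evalHom_invVar] using inv_le_one_of_one_le₀ (hz j)
    · simpa [evalHom_invVar] using inv_lt_one_of_one_lt₀ hz₀
  have hword (t : Fin m) := (tendsto_polylogSum (hnodup t) (hsum t)).const_mul (evalHom z (c t))
  simpa [hg, ← evalHom_apply, map_polylogSum, evalHom_invVar] using
    (tendsto_finsetSum univ fun t _ => hword t).add hB0

/-- The partial sums over `K ≥ k₁ ≥ ⋯ ≥ k_p ≥ 1` of the series of `seriesTerm`, as Laurent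
polynomials in `z`. -/
def partialSeries (P : MvPolynomial (Fin p) ℚ) (A n : Fin p → ℕ) : ℕ → Laurent p :=
  ∑ d ∈ P.support, P.coeff d • nestedSum ((List.finRange p).map fun j =>
    twist (invVar j) (shiftedPow 0 (-d j) * invPochhammer (n j) ^ A j))

lemma sum_map_finRange_degree (A : Fin p → ℕ) :
    ((List.finRange p).map fun j => ((1, A j, {j}) : ℕ × ℕ × Multiset (Fin p))).sum =
      (p, ∑ j, A j, univ.val) := by
  rw [← List.ofFn_eq_map, List.sum_ofFn]
  refine Prod.ext (by simp [Prod.fst_sum]) (Prod.ext (by simp [Prod.fst_sum, Prod.snd_sum]) ?_)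
  simp [Prod.snd_sum, Finset.sum_multiset_singleton]

lemma partialSeries_mem_nestSpan (hp : 0 < p) (P : MvPolynomial (Fin p) ℚ) (A n : Fin p → ℕ) :
    partialSeries P A n ∈ nestSpan invVar (p, ∑ j, A j, univ.val) {⟨0, hp⟩} := by
  refine sum_mem fun d _ => Submodule.smul_of_tower_mem _ _ ?_
  rw [← sum_map_finRange_degree]
  refine nestedSum_twist_mem_nestSpan isUnit_invVar
    (fun j => pow_mul_invPochhammer_pow_mem_polar (d j) (n j) (A j)) _ fun i hi => ?_
  obtain ⟨h, rfl⟩ := by simpa [List.head?_eq_getElem?, List.getElem?_eq_some_iff] using hi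
  rfl

lemma seriesTerm_eq_sum (P : MvPolynomial (Fin p) ℚ) (A n : Fin p → ℕ) (z : Fin p → ℂ)
    (k : Index p) :
    seriesTerm P A n z k = ∑ d ∈ P.support, ((P.coeff d : ℚ) : ℂ) * ∏ j,
      twist (z j)⁻¹ (shiftedPow 0 (-d j) * invPochhammer (n j) ^ A j) (k.1 j - 1) := by
  rw [seriesTerm, MvPolynomial.aeval_def, MvPolynomial.eval₂_eq', sum_div, sum_mul]
  refine sum_congr rfl fun d _ => ?_
  rw [mul_div_assoc, mul_assoc, ← prod_div_distrib, ← prod_mul_distrib]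
  refine congrArg _ (prod_congr rfl fun j _ => ?_)
  have hk : ((k.1 j - 1 : ℕ) : ℚ) + 1 = k.1 j := by
    exact_mod_cast Nat.sub_add_cancel (k.2.2 j)
  have hpochhammer : (((ascPochhammer ℚ (n j + 1)).eval (k.1 j : ℚ) : ℚ) : ℂ) =
      (ascPochhammer ℂ (n j + 1)).eval (k.1 j : ℂ) := by
    rw [← ascPochhammer_eval_cast, ← ascPochhammer_eval_cast, Rat.cast_natCast]
  rw [twist_apply, Pi.mul_apply, Pi.pow_apply, shiftedPow, invPochhammer, Nat.cast_zero, add_zero,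
    hk, Nat.sub_add_cancel (k.2.2 j), Rat.smul_def]
  push_cast
  rw [hpochhammer]
  simp [div_eq_mul_inv]

lemma evalHom_partialSeries (P : MvPolynomial (Fin p) ℚ) (A n : Fin p → ℕ) (z : Fin p → ℂˣ)
    (K : ℕ) : evalHom z (partialSeries P A n K) =
      ∑ k ∈ truncation p K, seriesTerm P A n (fun j => z j) k := by
  simp only [seriesTerm_eq_sum, partialSeries, Finset.sum_apply, Pi.smul_apply, map_sum, map_smul,
    map_nestedSum, ← List.ofFn_eq_map, List.map_ofFn, Function.comp_def, Rat.smul_def]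
  rw [sum_comm]
  simp only [← mul_sum]
  refine sum_congr rfl fun d _ => ?_
  simp only [← sum_truncation, map_twist, evalHom_invVar]

lemma summable_seriesTerm (P : MvPolynomial (Fin p) ℚ) (A n : Fin p → ℕ) (hp : 0 < p)
    {z : Fin p → ℂ} (hz₀ : 1 < ‖z ⟨0, hp⟩‖) (hz : ∀ j, 1 ≤ ‖z j‖) :
    Summable (seriesTerm P A n z) := by
  have hx (j : Fin p) : ‖(z j)⁻¹‖ ≤ 1 := by simpa using inv_le_one_of_one_le₀ (hz j)
  have hsub (d : Fin p →₀ ℕ) (j : Fin p) :=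
    isSubexponential_of_mem_polar (pow_mul_invPochhammer_pow_mem_polar (d j) (n j) (A j))
  rw [funext (seriesTerm_eq_sum P A n z)]
  refine summable_sum fun d _ => .mul_left _ (summable_prod_index (g := fun j =>
    twist (z j)⁻¹ (shiftedPow 0 (-d j) * invPochhammer (n j) ^ A j)) (fun j hj => ?_)
    fun j => (hsub d j).twist (hx j))
  obtain rfl : j = ⟨0, hp⟩ := Fin.ext hj
  exact .twist (by simpa using inv_lt_one_of_one_lt₀ hz₀) (hsub d _)

end Laurent

end MultiplePolylog

end

theorem mainTheorem2 {p : ℕ} (hp : 0 < p) (P : MvPolynomial (Fin p) ℚ) (A n : Fin p → ℕ)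
    (hA : ∀ j, 1 ≤ A j) :
    ∃ (m : ℕ) (q : Fin m → ℕ) (s : ∀ t : Fin m, Fin (q t) → ℤ)
      (S : ∀ t : Fin m, Fin (q t) → Finset (Fin p)) (c : Fin m → Laurent p),
      (∀ t, q t ≤ p ∧ weight (s t) ≤ ∑ j, (A j : ℤ) ∧ ∀ i, (S t i).Nonempty) ∧
      ∀ z : Fin p → ℂ, 1 < ‖z ⟨0, hp⟩‖ → (∀ j, j ≠ ⟨0, hp⟩ → 1 ≤ ‖z j‖) →
        (∀ t, Summable (laTerm (s t) fun i => 1 / ∏ j ∈ S t i, z j)) ∧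
        HasSum (seriesTerm P A n z)
          (∑ t, (c t).evalAt z * La (s t) fun i => 1 / ∏ j ∈ S t i, z j) := by
  obtain ⟨m, L, c, hL, hlim⟩ :=
    exists_la_expansion Finset.univ.nodup (partialSeries_mem_nestSpan hp P A n)
  refine ⟨m, fun t => (L t).length, fun t => exponents (L t), fun t => supports (L t), c,
    fun t => ⟨?_, ?_, fun i => ?_⟩, fun z hz₀ hz => ?_⟩
  · exact (length_eq_wordDegree_fst (L t)).trans_le (hL t).1.1
  · rw [weight_exponents]
    exact_mod_cast (hL t).1.2.1
  · exact Multiset.toFinset_nonempty.2 ((hL t).2 _ ((L t).get_mem i))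
  have hz' (j : Fin p) : 1 ≤ ‖z j‖ := by
    obtain rfl | hj := eq_or_ne j ⟨0, hp⟩
    exacts [hz₀.le, hz j hj]
  lift z to Fin p → ℂˣ using fun j =>
    isUnit_iff_ne_zero.2 (norm_pos_iff.1 (zero_lt_one.trans_le (hz' j)))
  obtain ⟨hsum, hlim⟩ := hlim z hz₀ hz'
  simp only [evalHom_partialSeries] at hlim
  exact ⟨hsum, hasSum_of_tendsto_truncation (summable_seriesTerm P A n hp hz₀ hz') hlim⟩
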